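/- **Setting.** A model $\mathcal{D}$ is a set of probability distributions over $\mathbb{R}$ with finite first moments; $\mathrm{E}(\zeta)$ denotes the expectation of $\zeta$. A $K$-armed bandit problem in $\mathcal{D}$ is a tuple $\underline{\nu}=(\nu_1,\dots,\nu_K)$ of elements of $\mathcal{D}$, with expectations $\mu_1,\dots,\mu_K$. It is generic if $\mu_j\neq\mu_k$ for $j\neq k$; then $a^\star(\underline{\nu})$ and $w_\star(\underline{\nu})$ denote its unique best and worst arms (largest and smallest expectation), $\nu^\star=\nu_{a^\star(\underline{\nu})}$, and $\mu_{(1)}>\mu_{(2)}>\dots>\mu_{(K)}$ are its expectations in decreasing order. For $x\in\mathbb{R}$ let $$\mathcal{L}^{<}_{\inf}(x,\nu)=\inf\bigl\{\mathrm{KL}(\zeta,\nu):\ \zeta\in\mathcal{D},\ \mathrm{E}(\zeta)<x\bigr\}\in[0,+\infty],\qquad \inf\emptyset=+\infty .$$ A strategy for $K$ arms and budget $T$ picks at each round $t=1,\dots,T$ an arm $A_t$ that is a measurable function of the history $(U_0,Y_1,U_1,\dots,Y_{t-1},U_{t-1})$, where $U_0,U_1,\dots$ are independent auxiliary randomizations;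 it then observes a payoff $Y_t$ drawn from $\nu_{A_t}$, and $U_t$ is drawn independently of $Y_t$ and the past. After round $T$ it recommends an arm $I_T$ that is a measurable function of $(U_0,Y_1,U_1,\dots,Y_T,U_T)$. Let $N_a(T)=\sum_{t=1}^T \mathbf{1}_{\{A_t=a\}}$, and write $\mathbb{P}_{\underline{\nu}},\mathbb{E}_{\underline{\nu}}$ for probability and expectation under the problem $\underline{\nu}$. A doubly-indexed sequence of strategies consists of one strategy for each number $K\ge 2$ of arms and each budget $T$. On a model $\mathcal{D}$ it is * *consistent* if for all $K\ge2$ and all generic $K$-armed problems $\underline{\nu}$ in $\mathcal{D}$, $\mathbb{P}_{\underline{\nu}}(I_T\neq a^\star(\underline{\nu}))\to 0$ as $T\to+\infty$; * *balanced against the worst arm* if for all $K\ge2$ and all generic $K$-armed problems $\underline{\nu}$ in $\mathcal{D}$, $\limsup_{T\to+\infty}\frac1T\,\mathbb{E}_{\underline{\nu}}[N_{w_\star(\underline{\nu})}(T)]\le\frac1K$; * *cleverly exploiting the pruning of suboptimal arms* if for all $K\ge2$, all generic $K$-armed problems $\underline{\nu}$ in $\mathcal{D}$ and all subproblems $\underline{\nu}'=(\nu_a)_{a\in\mathcal{A}}$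 (with $\mathcal{A}\subseteq\{1,\dots,K\}$ of cardinality at least $2$, arms renumbered in increasing order) such that $\nu'_{a^\star(\underline{\nu}')}=\nu_{a^\star(\underline{\nu})}$, $$\liminf_{T\to+\infty}\frac1T\ln\mathbb{P}_{\underline{\nu}}\bigl(I_T\neq a^\star(\underline{\nu})\bigr)\ \ge\ \liminf_{T\to+\infty}\frac1T\ln\mathbb{P}_{\underline{\nu}'}\bigl(I_T\neq a^\star(\underline{\nu}')\bigr).$$ (Here $\ln 0=-\infty$, and limits are taken in $[-\infty,+\infty]$.) **Theorem.** Fix a model $\mathcal{D}$. Consider a doubly-indexed sequence of strategies that is consistent on $\mathcal{D}$, balanced against the worst arm on $\mathcal{D}$, and that cleverly exploits the pruning of suboptimal arms on $\mathcal{D}$. Then for all $K\ge2$ and all generic $K$-armed bandit problems $\underline{\nu}$ in $\mathcal{D}$, $$\liminf_{T\to+\infty}\frac1T\ln\mathbb{P}_{\underline{\nu}}\bigl(I_T\neq a^\star(\underline{\nu})\bigr)\ \ge\ -\min_{2\le k\le K}\frac{\mathcal{L}^{<}_{\inf}\bigl(\mu_{(k)},\nu^\star\bigr)}{k}.$$ 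-/

import Mathlib

open MeasureTheory ProbabilityTheory Filter Topology
open scoped ENNReal

namespace BestArm

universe u

/-! ### Distributions, models, bandit problems -/

/-- The expectation `E(ζ)` of a probability distribution `ζ` over `ℝ`. -/
noncomputable def mean (ζ : ProbabilityMeasure ℝ) : ℝ := ∫ x, x ∂(ζ : Measure ℝ)

/-- A model is a set of probability distributions over `ℝ` that all admit an expectation. -/
def IsModel (D : Set (ProbabilityMeasure ℝ)) : Prop :=
  ∀ ζ ∈ D, Integrable (fun x : ℝ => x) (ζ : Measure ℝ)

/-- `𝓛^<_inf(x, ν)`, the infimum of `KL(ζ, ν)` over the `ζ` in the model with `E(ζ) < x`;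
it is `∞` when there is no such `ζ`. -/
noncomputable def Linf (D : Set (ProbabilityMeasure ℝ)) (x : ℝ) (ν : ProbabilityMeasure ℝ) :
    ℝ≥0∞ :=
  ⨅ ζ ∈ D, ⨅ _ : mean ζ < x, InformationTheory.klDiv (ζ : Measure ℝ) (ν : Measure ℝ)

/-- A `K`-armed bandit problem: one distribution for each arm. The arms `1, …, K` are
represented by the elements `0, …, K - 1` of `Fin K`. -/
abbrev Problem (K : ℕ) : Type := Fin K → ProbabilityMeasure ℝ

variable {K : ℕ}

/-- The problem `ν` is in the model `D`. -/
def Problem.InModel (ν : Problem K) (D : Set (ProbabilityMeasure ℝ)) : Prop := ∀ a, ν a ∈ D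

/-- A problem is generic if no two of its arms have the same expectation. -/
def Problem.Generic (ν : Problem K) : Prop := ∀ j k, j ≠ k → mean (ν j) ≠ mean (ν k)

/-- `a` is an optimal arm of `ν`. (In a generic problem with at least one arm
there is exactly one such arm, `a⋆(ν)`.) -/
def Problem.IsBest (ν : Problem K) (a : Fin K) : Prop := ∀ b, mean (ν b) ≤ mean (ν a)

/-- `w` is a worst arm of `ν`. (In a generic problem with at least one arm
there is exactly one such arm, `w⋆(ν)`.) -/
def Problem.IsWorst (ν : Problem K) (w : Fin K) : Prop := ∀ b, mean (ν w) ≤ mean (ν b)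

/-- The order statistics of the expectations, in decreasing order: `ν.orderedMean i` is
`μ_(k)` with `k = i + 1`, so that `μ_(1) ≥ μ_(2) ≥ ⋯ ≥ μ_(K)`. -/
noncomputable def Problem.orderedMean (ν : Problem K) (i : Fin K) : ℝ :=
  mean (ν (Tuple.sort (fun a => -mean (ν a)) i))

/-- The subproblem `(ν_a)_{a ∈ A}`, whose `A.card` arms are numbered in increasing order. -/
def Problem.restrict (ν : Problem K) (A : Finset (Fin K)) : Problem A.card :=
  fun i => ν (A.orderEmbOfFin rfl i)

/-! ### Histories and strategies -/

/-- Histories after `t` rounds: `(U_0, Y_1, U_1, …, Y_t, U_t)`, where the payoffs `Y_s` are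
real numbers and the auxiliary randomizations `U_s` are elements of `𝒰`. -/
def History (𝒰 : Type u) : ℕ → Type u
  | 0 => 𝒰
  | t + 1 => History 𝒰 t × (ℝ × 𝒰)

noncomputable instance History.instMeasurableSpace (𝒰 : Type u) [m : MeasurableSpace 𝒰] :
    (t : ℕ) → MeasurableSpace (History 𝒰 t)
  | 0 => m
  | t + 1 => @Prod.instMeasurableSpace (History 𝒰 t) (ℝ × 𝒰)
      (History.instMeasurableSpace 𝒰 t) inferInstance

/-- A strategy for `K` arms and the budget `T`. The arm picked at round `t + 1` is
`A_{t+1} = sample t h`, where `h` is the history after `t` rounds (only the values for `t < T`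
matter), and the recommended arm is `I_T = recommend h`, where `h` is the history after `T`
rounds. The auxiliary randomizations `U_0, U_1, …` are drawn independently,
`U_t` according to `auxLaw t`. -/
structure Strategy (𝒰 : Type u) [MeasurableSpace 𝒰] (K T : ℕ) where
  auxLaw : ℕ → ProbabilityMeasure 𝒰
  sample : (t : ℕ) → History 𝒰 t → Fin K
  measurable_sample : ∀ t, Measurable (sample t)
  recommend : History 𝒰 T → Fin K
  measurable_recommend : Measurable recommend

variable {𝒰 : Type u} [MeasurableSpace 𝒰] {T : ℕ}

/-- The conditional law of `(Y_{t+1}, U_{t+1})` given the history `h` after `t` rounds, under the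
problem `ν`: it is `ν_a ⊗ auxLaw (t + 1)`, where `a = sample t h` is the arm picked. -/
noncomputable def Strategy.step (S : Strategy 𝒰 K T) (ν : Problem K) (t : ℕ) :
    Kernel (History 𝒰 t) (ℝ × 𝒰) :=
  (Kernel.ofFunOfCountable fun a : Fin K =>
      (ν a : Measure ℝ).prod (S.auxLaw (t + 1) : Measure 𝒰)).comap
    (S.sample t) (S.measurable_sample t)

/-- The law, under the problem `ν`, of the history after `t` rounds. -/
noncomputable def Strategy.law (S : Strategy 𝒰 K T) (ν : Problem K) :
    (t : ℕ) → Measure (History 𝒰 t)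
  | 0 => (S.auxLaw 0 : Measure 𝒰)
  | t + 1 => (S.law ν t).compProd (S.step ν t)

/-- The number `N_a(t)` of times that arm `a` was picked in the first `t` rounds,
as a function of the history. -/
def Strategy.pulls (S : Strategy 𝒰 K T) (a : Fin K) : (t : ℕ) → History 𝒰 t → ℕ
  | 0, _ => 0
  | t + 1, h => S.pulls a t h.1 + if S.sample t h.1 = a then 1 else 0

/-- `𝔼_ν[N_a(T)]`. -/
noncomputable def Strategy.expectedPulls (S : Strategy 𝒰 K T) (ν : Problem K) (a : Fin K) :
    ℝ≥0∞ :=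
  ∫⁻ h, (S.pulls a T h : ℝ≥0∞) ∂(S.law ν T)

/-- `ℙ_ν(I_T ≠ a)`. -/
noncomputable def Strategy.errorProb (S : Strategy 𝒰 K T) (ν : Problem K) (a : Fin K) : ℝ≥0∞ :=
  S.law ν T {h | S.recommend h ≠ a}

/-! ### Doubly-indexed sequences of strategies -/

/-- A sequence of strategies indexed by the number `K ≥ 2` of arms and by the budget `T`. -/
abbrev StrategySeq (𝒰 : Type u) [MeasurableSpace 𝒰] : Type u :=
  (K : ℕ) → 2 ≤ K → (T : ℕ) → Strategy 𝒰 K T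

/-- `liminf_{T → ∞} (1/T) ln ℙ_ν(I_T ≠ a)`, as an extended real number (`ln 0 = -∞`). -/
noncomputable def StrategySeq.errorRate (σ : StrategySeq 𝒰) (hK : 2 ≤ K) (ν : Problem K)
    (a : Fin K) : EReal :=
  liminf (fun T : ℕ => ENNReal.log ((σ K hK T).errorProb ν a) / (T : EReal)) atTop

/-- Consistency on the model `D`: `ℙ_ν(I_T ≠ a⋆(ν)) → 0` for all generic problems in `D`. -/
def StrategySeq.Consistent (σ : StrategySeq 𝒰) (D : Set (ProbabilityMeasure ℝ)) : Prop :=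
  ∀ (K : ℕ) (hK : 2 ≤ K) (ν : Problem K), ν.InModel D → ν.Generic →
    ∀ a, ν.IsBest a → Tendsto (fun T : ℕ => (σ K hK T).errorProb ν a) atTop (𝓝 0)

/-- Balancedness against the worst arm on the model `D`:
`limsup_{T → ∞} 𝔼_ν[N_w(T)] / T ≤ 1 / K`, where `w = w⋆(ν)`, for all generic problems in `D`. -/
def StrategySeq.BalancedAgainstWorst (σ : StrategySeq 𝒰) (D : Set (ProbabilityMeasure ℝ)) :
    Prop :=
  ∀ (K : ℕ) (hK : 2 ≤ K) (ν : Problem K), ν.InModel D → ν.Generic →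
    ∀ w, ν.IsWorst w →
      limsup (fun T : ℕ => (σ K hK T).expectedPulls ν w / (T : ℝ≥0∞)) atTop ≤ 1 / (K : ℝ≥0∞)

/-- Clever exploitation of the pruning of suboptimal arms on the model `D`: for all generic
problems `ν` in `D` and all subproblems `ν'` with at least two arms that feature the same optimal
arm, `liminf (1/T) ln ℙ_ν(I_T ≠ a⋆(ν)) ≥ liminf (1/T) ln ℙ_ν'(I_T ≠ a⋆(ν'))`. -/
def StrategySeq.CleverlyPrunes (σ : StrategySeq 𝒰) (D : Set (ProbabilityMeasure ℝ)) : Prop :=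
  ∀ (K : ℕ) (hK : 2 ≤ K) (ν : Problem K), ν.InModel D → ν.Generic →
    ∀ (A : Finset (Fin K)) (hA : 2 ≤ A.card) (a : Fin K) (a' : Fin A.card),
      ν.IsBest a → (ν.restrict A).IsBest a' → ν.restrict A a' = ν a →
        σ.errorRate hA (ν.restrict A) a' ≤ σ.errorRate hK ν a

end BestArm

namespace BestArm

universe u

/-! Fix `k ≥ 2` and keep only the `k` best arms. If the best arm `a` is replaced by some `ζ` in `D`
with mean below `μ_(k)`, then `a` becomes the worst of these `k` arms. In the modified problem,
balancedness gives `a` at most about `T / k` expected pulls, and consistency makes `I_T ≠ a` almost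
certain. The two problems differ only through the pulls of `a`, so by Wald's identity the
log-likelihood ratio has expectation `KL(ζ, ν⋆) · E[N_a(T)]`, at most about `T · KL(ζ, ν⋆) / k`. A
change of measure (`mul_exp_neg_le_measureReal`, `Strategy.mul_exp_neg_le_errorProb`) turns this
into the rate bound `-KL(ζ, ν⋆) / k` for the `k`-armed subproblem
(`StrategySeq.neg_klDiv_div_le_errorRate`). Clever pruning carries the bound to the full problem; it
remains to optimize over `ζ` and `k`. -/

/-! ### Change of measure on a single space -/

/-- A change of measure: `e^{-llr ζ ν} ζ ≤ ν` whenever `ζ ≪ ν`. -/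
lemma lintegral_mul_exp_neg_llr_le {α : Type*} [MeasurableSpace α] (ζ ν : Measure α)
    [IsFiniteMeasure ζ] [IsFiniteMeasure ν] (hζ : ζ ≪ ν) {g : α → ℝ≥0∞} (hg : Measurable g) :
    ∫⁻ x, g x * ENNReal.ofReal (Real.exp (-llr ζ ν x)) ∂ζ ≤ ∫⁻ x, g x ∂ν := by
  calc ∫⁻ x, g x * ENNReal.ofReal (Real.exp (-llr ζ ν x)) ∂ζ
      ≤ ∫⁻ x, ν.rnDeriv ζ x * g x ∂ζ := by
        refine lintegral_mono_ae ?_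
        filter_upwards [exp_neg_llr hζ] with x hx
        rw [hx, mul_comm]
        gcongr
        exact ENNReal.ofReal_toReal_le
    _ = ∫⁻ x, g x ∂(ζ.withDensity (ν.rnDeriv ζ)) :=
        (lintegral_withDensity_eq_lintegral_mul _ (Measure.measurable_rnDeriv ν ζ) hg).symm
    -- The part of `ν` singular to `ζ` is lost, hence only an inequality.
    _ ≤ ∫⁻ x, g x ∂ν := lintegral_mono' (Measure.withDensity_rnDeriv_le ν ζ) le_rfl

/-- A lower bound on `Q E` when `Q` dominates `e^{-L} P`. -/
lemma mul_exp_neg_le_measureReal {Ω : Type*} [MeasurableSpace Ω] (P Q : Measure Ω)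
    [IsProbabilityMeasure P] [IsProbabilityMeasure Q] {L : Ω → ℝ} (hLm : Measurable L)
    (hL : Integrable L P)
    (hPQ : ∀ s, MeasurableSet s → ∫⁻ x in s, ENNReal.ofReal (Real.exp (-L x)) ∂P ≤ Q s)
    {E : Set Ω} (hE : MeasurableSet E) (hp : 0 < P.real E) :
    P.real E * Real.exp (-((∫ x, L x ∂P + 1) / P.real E)) ≤ Q.real E := by
  have hexp : Measurable fun x => Real.exp (-L x) := by fun_prop
  have hint : Integrable (fun x => Real.exp (-L x)) P := by
    refine ⟨hexp.aestronglyMeasurable, ?_⟩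
    rw [hasFiniteIntegral_iff_ofReal (ae_of_all _ fun x => (Real.exp_pos _).le)]
    have h := hPQ Set.univ MeasurableSet.univ
    rw [Measure.restrict_univ] at h
    exact h.trans_lt (measure_lt_top _ _)
  have hset : ∀ s, MeasurableSet s → ∫ x in s, Real.exp (-L x) ∂P ≤ Q.real s := by
    intro s hs
    rw [integral_eq_lintegral_of_nonneg_ae (ae_of_all _ fun x => (Real.exp_pos _).le)
      hexp.aestronglyMeasurable]
    exact ENNReal.toReal_mono (measure_ne_top _ _) (hPQ s hs)
  -- The `+ 1` of the statement arises here: it bounds what a negative `L` off `E` can contribute.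
  have hcompl : -∫ x in Eᶜ, L x ∂P ≤ 1 := by
    rw [← integral_neg]
    calc ∫ x in Eᶜ, -L x ∂P ≤ ∫ x in Eᶜ, Real.exp (-L x) ∂P := by
          refine integral_mono hL.neg.integrableOn hint.integrableOn fun x => ?_
          have := Real.add_one_le_exp (-L x)
          dsimp only
          linarith
      _ ≤ Q.real Eᶜ := hset _ hE.compl
      _ ≤ 1 := measureReal_le_one
  have hsplit : ∫ x in E, L x ∂P ≤ ∫ x, L x ∂P + 1 := by
    rw [← integral_add_compl hE hL]
    linarith
  -- `c` bounds the average of `L` over `E`. The tangent to `exp` at `-c` then plays the role of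
  -- Jensen's inequality.
  set c := (∫ x, L x ∂P + 1) / P.real E with hc
  have hc' : c * P.real E = ∫ x, L x ∂P + 1 := div_mul_cancel₀ _ hp.ne'
  refine le_trans ?_ (hset E hE)
  have hlow : ∫ x in E, Real.exp (-c) * ((1 + c) - L x) ∂P ≤ ∫ x in E, Real.exp (-L x) ∂P := by
    refine integral_mono (((integrable_const _).sub hL.integrableOn).const_mul _)
      hint.integrableOn fun x => ?_
    have h1 := Real.add_one_le_exp (c - L x)
    have h2 : Real.exp (-L x) = Real.exp (-c) * Real.exp (c - L x) := by
      rw [← Real.exp_add]; ring_nf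
    dsimp only
    rw [h2]
    gcongr
    linarith
  refine le_trans ?_ hlow
  rw [integral_const_mul, integral_sub (integrable_const _) hL.integrableOn, setIntegral_const,
    smul_eq_mul, mul_comm]
  gcongr
  nlinarith

/-! ### Laws of histories, Wald's identity and change of measure along a history -/

variable {K T : ℕ} {𝒰 : Type u} [MeasurableSpace 𝒰]

namespace Strategy

lemma step_apply (S : Strategy 𝒰 K T) (ν : Problem K) (t : ℕ) (h : History 𝒰 t) :
    S.step ν t h = (ν (S.sample t h) : Measure ℝ).prod (S.auxLaw (t + 1) : Measure 𝒰) := rfl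

instance (S : Strategy 𝒰 K T) (ν : Problem K) (t : ℕ) : IsMarkovKernel (S.step ν t) :=
  ⟨fun h => by rw [step_apply]; infer_instance⟩

lemma law_succ (S : Strategy 𝒰 K T) (ν : Problem K) (t : ℕ) :
    S.law ν (t + 1) = (S.law ν t).compProd (S.step ν t) := rfl

instance (S : Strategy 𝒰 K T) (ν : Problem K) (t : ℕ) : IsProbabilityMeasure (S.law ν t) := by
  induction t with
  | zero => exact inferInstanceAs (IsProbabilityMeasure (S.auxLaw 0 : Measure 𝒰))
  | succ t ih =>
    exact inferInstanceAs (IsProbabilityMeasure ((S.law ν t).compProd (S.step ν t)))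

lemma lintegral_law_succ (S : Strategy 𝒰 K T) (ν : Problem K) (t : ℕ)
    {g : History 𝒰 (t + 1) → ℝ≥0∞} (hg : Measurable g) :
    ∫⁻ h, g h ∂(S.law ν (t + 1))
      = ∫⁻ h, ∫⁻ y, ∫⁻ u, g (h, (y, u)) ∂(S.auxLaw (t + 1) : Measure 𝒰)
        ∂(ν (S.sample t h) : Measure ℝ) ∂(S.law ν t) := by
  refine (Measure.lintegral_compProd (μ := S.law ν t) (κ := S.step ν t) hg).trans ?_
  refine lintegral_congr fun h => ?_
  rw [step_apply, lintegral_prod]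
  exact (hg.comp measurable_prodMk_left).aemeasurable

/-- The sum of `f(Y_s)` over the rounds `s ≤ t` at which arm `a` is picked. -/
noncomputable def armSum (S : Strategy 𝒰 K T) (a : Fin K) (f : ℝ → ℝ) :
    (t : ℕ) → History 𝒰 t → ℝ
  | 0, _ => 0
  | t + 1, h => S.armSum a f t h.1 + if S.sample t h.1 = a then f h.2.1 else 0

lemma measurableSet_sample_eq (S : Strategy 𝒰 K T) (a : Fin K) (t : ℕ) :
    MeasurableSet {h | S.sample t h = a} :=
  S.measurable_sample t (measurableSet_singleton a)

lemma measurable_ite_sample (S : Strategy 𝒰 K T) (a : Fin K) {f : ℝ → ℝ} (hf : Measurable f)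
    (t : ℕ) : Measurable fun h : History 𝒰 t × (ℝ × 𝒰) =>
      if S.sample t h.1 = a then f h.2.1 else 0 :=
  Measurable.ite (measurable_fst (S.measurableSet_sample_eq a t))
    (hf.comp (measurable_fst.comp measurable_snd)) measurable_const

lemma measurable_armSum (S : Strategy 𝒰 K T) (a : Fin K) {f : ℝ → ℝ} (hf : Measurable f) :
    ∀ t, Measurable (S.armSum a f t)
  | 0 => measurable_const
  | t + 1 => ((S.measurable_armSum a hf t).comp measurable_fst).add
      (S.measurable_ite_sample a hf t)

lemma armSum_const (S : Strategy 𝒰 K T) (a : Fin K) (c : ℝ) :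
    ∀ t h, S.armSum a (fun _ => c) t h = c * S.pulls a t h
  | 0, _ => by simp [armSum, pulls]
  | t + 1, h => by
    simp only [armSum, pulls, S.armSum_const a c t h.1]
    split_ifs <;> push_cast <;> ring

lemma armSum_sub (S : Strategy 𝒰 K T) (a : Fin K) (f g : ℝ → ℝ) :
    ∀ t h, S.armSum a (fun y => f y - g y) t h = S.armSum a f t h - S.armSum a g t h
  | 0, _ => by simp [armSum]
  | t + 1, h => by
    simp only [armSum, S.armSum_sub a f g t h.1]
    split_ifs <;> ring

/-- Sums of centered payoff functionals are integrable and centered. -/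
lemma integrable_armSum_and_integral_eq_zero (S : Strategy 𝒰 K T) (ν : Problem K) (a : Fin K)
    {f : ℝ → ℝ} (hfm : Measurable f) (hf : Integrable f (ν a : Measure ℝ))
    (h0 : ∫ y, f y ∂(ν a : Measure ℝ) = 0) (t : ℕ) :
    Integrable (S.armSum a f t) (S.law ν t) ∧ ∫ h, S.armSum a f t h ∂(S.law ν t) = 0 := by
  induction t with
  | zero => exact ⟨integrable_zero _ _ _, integral_zero _ _⟩
  | succ t ih =>
    have hfst : (S.law ν (t + 1)).map Prod.fst = S.law ν t := by
      rw [law_succ]; exact Measure.fst_compProd _ _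
    have hprev : Integrable (fun h : History 𝒰 (t + 1) => S.armSum a f t h.1)
        (S.law ν (t + 1)) := by
      have := ih.1
      rw [← hfst] at this
      exact this.comp_measurable measurable_fst
    have hprev0 : ∫ h : History 𝒰 (t + 1), S.armSum a f t h.1 ∂(S.law ν (t + 1)) = 0 := by
      rw [← ih.2]
      conv_rhs => rw [← hfst]
      exact (integral_map measurable_fst.aemeasurable
        (S.measurable_armSum a hfm t).aestronglyMeasurable).symm
    have hGm := S.measurable_ite_sample a hfm t
    have hG : Integrable (fun h : History 𝒰 t × (ℝ × 𝒰) =>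
        if S.sample t h.1 = a then f h.2.1 else 0) ((S.law ν t).compProd (S.step ν t)) := by
      refine ⟨hGm.aestronglyMeasurable, ?_⟩
      change ∫⁻ h, _ ∂(S.law ν (t + 1)) < ∞
      rw [S.lintegral_law_succ ν t hGm.enorm]
      refine lt_of_le_of_lt (lintegral_mono (g := fun _ => ∫⁻ y, ‖f y‖ₑ ∂(ν a : Measure ℝ))
        fun h => ?_) ?_
      · by_cases hs : S.sample t h = a <;> simp [hs]
      · rw [lintegral_const, measure_univ, mul_one]
        exact hf.2
    have hG0 : ∫ h : History 𝒰 t × (ℝ × 𝒰), (if S.sample t h.1 = a then f h.2.1 else 0)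
        ∂((S.law ν t).compProd (S.step ν t)) = 0 := by
      rw [Measure.integral_compProd hG]
      refine integral_eq_zero_of_ae (ae_of_all _ fun h => ?_)
      by_cases hs : S.sample t h = a
      · simp only [hs, if_true, step_apply, Pi.zero_apply]
        rw [integral_fun_fst (μ := (ν a : Measure ℝ)) (ν := (S.auxLaw (t + 1) : Measure 𝒰)) f, h0,
          smul_zero]
      · simp [hs]
    refine ⟨hprev.add hG, ?_⟩
    have := integral_add hprev hG
    rw [hprev0] at this
    exact this.trans (by rw [zero_add]; exact hG0)

/-- Change of measure along the history when only the law of arm `a` is modified. -/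
lemma lintegral_mul_exp_neg_armSum_le (S : Strategy 𝒰 K T) (ν ν' : Problem K) (a : Fin K)
    (hne : ∀ b, b ≠ a → ν' b = ν b) (hac : (ν' a : Measure ℝ) ≪ (ν a : Measure ℝ)) (t : ℕ)
    {g : History 𝒰 t → ℝ≥0∞} (hg : Measurable g) :
    ∫⁻ h, g h * ENNReal.ofReal
        (Real.exp (-S.armSum a (llr (ν' a : Measure ℝ) (ν a : Measure ℝ)) t h)) ∂(S.law ν' t)
      ≤ ∫⁻ h, g h ∂(S.law ν t) := by
  set ℓ := llr (ν' a : Measure ℝ) (ν a : Measure ℝ) with hℓ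
  have hℓm : Measurable ℓ := measurable_llr _ _
  induction t with
  | zero => simp [armSum, law]
  | succ t ih =>
    have hLm := S.measurable_armSum a hℓm
    have hgL : Measurable fun h => g h * ENNReal.ofReal (Real.exp (-S.armSum a ℓ (t + 1) h)) :=
      hg.mul (hLm (t + 1)).neg.exp.ennreal_ofReal
    rw [S.lintegral_law_succ ν' t hgL, S.lintegral_law_succ ν t hg]
    set G : History 𝒰 t → ℝ → ℝ≥0∞ := fun h y =>
      ∫⁻ u, g (h, (y, u)) ∂(S.auxLaw (t + 1) : Measure 𝒰) with hG
    have hgu : ∀ h y, Measurable fun u => g (h, (y, u)) := fun h y =>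
      hg.comp (measurable_prodMk_left.comp measurable_prodMk_left)
    have hGm : ∀ h, Measurable (G h) := fun h =>
      Measurable.lintegral_prod_right' (f := fun p : ℝ × 𝒰 => g (h, p))
        (hg.comp measurable_prodMk_left)
    have hGint : Measurable fun h => ∫⁻ y, G h y ∂(ν (S.sample t h) : Measure ℝ) := by
      have h1 : Measurable fun h => ∫⁻ p, g (h, p) ∂(S.step ν t h) :=
        Measurable.lintegral_kernel_prod_right' hg
      convert h1 using 2 with h
      rw [step_apply, lintegral_prod]
      exact (hg.comp measurable_prodMk_left).aemeasurable
    -- The induction hypothesis is applied to `g` averaged over the last round under `ν`; what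
    -- remains is a one-round comparison for each fixed past `h`.
    refine le_trans (lintegral_mono fun h => ?_) (ih hGint)
    have hpt : ∀ y, ∫⁻ u, g (h, (y, u)) * ENNReal.ofReal
          (Real.exp (-S.armSum a ℓ (t + 1) (h, (y, u)))) ∂(S.auxLaw (t + 1) : Measure 𝒰)
        = G h y * ENNReal.ofReal (Real.exp (-if S.sample t h = a then ℓ y else 0))
          * ENNReal.ofReal (Real.exp (-S.armSum a ℓ t h)) := by
      intro y
      rw [hG, mul_assoc, ← ENNReal.ofReal_mul (Real.exp_pos _).le, ← Real.exp_add,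
        ← lintegral_mul_const _ (hgu h y)]
      refine lintegral_congr fun u => ?_
      simp only [armSum]
      congr 3
      ring
    simp only [hpt]
    rw [lintegral_mul_const']
    swap
    · exact ENNReal.ofReal_ne_top
    refine mul_le_mul_left ?_ _
    by_cases hs : S.sample t h = a
    · simp only [hs, if_true]
      exact lintegral_mul_exp_neg_llr_le _ _ hac (hGm h)
    · simp [hs, hne _ hs, hG]

lemma measurable_pulls (S : Strategy 𝒰 K T) (a : Fin K) : ∀ t, Measurable (S.pulls a t)
  | 0 => measurable_const
  | t + 1 => ((S.measurable_pulls a t).comp measurable_fst).add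
      (Measurable.ite (measurable_fst (S.measurableSet_sample_eq a t))
        measurable_const measurable_const)

lemma pulls_le (S : Strategy 𝒰 K T) (a : Fin K) : ∀ t h, S.pulls a t h ≤ t
  | 0, _ => le_rfl
  | t + 1, h => by
    simp only [pulls]
    have := S.pulls_le a t h.1
    split_ifs <;> omega

lemma integrable_pulls (S : Strategy 𝒰 K T) (ν : Problem K) (a : Fin K) :
    Integrable (fun h => (S.pulls a T h : ℝ)) (S.law ν T) := by
  refine Integrable.of_bound (C := T)
    (measurable_from_top.comp (S.measurable_pulls a T)).aestronglyMeasurable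
    (ae_of_all _ fun h => ?_)
  simpa using S.pulls_le a T h

lemma integral_pulls (S : Strategy 𝒰 K T) (ν : Problem K) (a : Fin K) :
    ∫ h, (S.pulls a T h : ℝ) ∂(S.law ν T) = (S.expectedPulls ν a).toReal := by
  rw [integral_eq_lintegral_of_nonneg_ae (ae_of_all _ fun h => Nat.cast_nonneg _)
    (S.integrable_pulls ν a).aestronglyMeasurable]
  simp [expectedPulls]

/-- Wald's identity for the log-likelihood ratio. -/
lemma integral_armSum_llr (S : Strategy 𝒰 K T) (ν : Problem K) (a : Fin K)
    (ξ : ProbabilityMeasure ℝ)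
    (hkl : InformationTheory.klDiv (ν a : Measure ℝ) (ξ : Measure ℝ) ≠ ∞) :
    Integrable (S.armSum a (llr (ν a : Measure ℝ) (ξ : Measure ℝ)) T) (S.law ν T) ∧
    ∫ h, S.armSum a (llr (ν a : Measure ℝ) (ξ : Measure ℝ)) T h ∂(S.law ν T)
      = (InformationTheory.klDiv (ν a : Measure ℝ) (ξ : Measure ℝ)).toReal
        * (S.expectedPulls ν a).toReal := by
  obtain ⟨hac, hint⟩ := InformationTheory.klDiv_ne_top_iff.mp hkl
  set ℓ := llr (ν a : Measure ℝ) (ξ : Measure ℝ) with hℓ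
  have hℓm : Measurable ℓ := measurable_llr _ _
  have hkl' := InformationTheory.toReal_klDiv_of_measure_eq hac (by simp)
  rw [← hℓ] at hkl'
  set c := (InformationTheory.klDiv (ν a : Measure ℝ) (ξ : Measure ℝ)).toReal with hc
  -- Subtracting its mean `c` centers the log-likelihood ratio; the compensator is `c` times the
  -- number of pulls.
  obtain ⟨h1, h2⟩ := S.integrable_armSum_and_integral_eq_zero ν a (f := fun y => ℓ y - c)
    (hℓm.sub_const c) (hint.sub (integrable_const c))
    (by rw [integral_sub hint (integrable_const c), ← hkl']; simp) T
  have hp := (S.integrable_pulls ν a).const_mul c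
  have heq : S.armSum a ℓ T = fun h =>
      S.armSum a (fun y => ℓ y - c) T h + c * (S.pulls a T h : ℝ) := by
    funext h
    rw [S.armSum_sub a ℓ (fun _ => c), armSum_const]
    ring
  rw [heq]
  refine ⟨h1.add hp, ?_⟩
  rw [integral_add h1 hp, h2, zero_add, integral_const_mul, integral_pulls]

/-- The fundamental inequality for lower bounds: the error probability under `ν` is at least
exponentially small in the divergence to an alternative that only modifies arm `a`. -/
lemma mul_exp_neg_le_errorProb (S : Strategy 𝒰 K T) (ν ν' : Problem K) (a : Fin K)
    (hne : ∀ b, b ≠ a → ν' b = ν b)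
    (hkl : InformationTheory.klDiv (ν' a : Measure ℝ) (ν a : Measure ℝ) ≠ ∞)
    (hp : 0 < (S.errorProb ν' a).toReal) :
    (S.errorProb ν' a).toReal * Real.exp (-(((InformationTheory.klDiv (ν' a : Measure ℝ)
        (ν a : Measure ℝ)).toReal * (S.expectedPulls ν' a).toReal + 1)
          / (S.errorProb ν' a).toReal))
      ≤ (S.errorProb ν a).toReal := by
  obtain ⟨hint, heq⟩ := S.integral_armSum_llr ν' a (ν a) hkl
  have hLm := S.measurable_armSum a (measurable_llr (ν' a : Measure ℝ) (ν a : Measure ℝ)) T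
  have hE : MeasurableSet {h | S.recommend h ≠ a} :=
    (S.measurable_recommend (measurableSet_singleton a)).compl
  rw [← heq]
  refine mul_exp_neg_le_measureReal (S.law ν' T) (S.law ν T) hLm hint (fun s hs => ?_) hE hp
  have := S.lintegral_mul_exp_neg_armSum_le ν ν' a hne
    (InformationTheory.klDiv_ne_top_iff.mp hkl).1 T (measurable_one.indicator hs)
  rw [lintegral_indicator_one hs] at this
  refine le_trans (le_of_eq ?_) this
  rw [← lintegral_indicator hs]
  refine lintegral_congr fun h => ?_
  by_cases hh : h ∈ s <;> simp [hh]

end Strategy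

/-! ### Error rates against one alternative -/

/-- The lower bound on the error rate obtained from an alternative problem in which the arm `a`
is replaced by a distribution that makes it the worst arm. -/
lemma StrategySeq.neg_klDiv_div_le_errorRate {D : Set (ProbabilityMeasure ℝ)}
    {σ : StrategySeq 𝒰} (hcons : σ.Consistent D) (hbal : σ.BalancedAgainstWorst D)
    (hK : 2 ≤ K) {ν : Problem K} (hνD : ν.InModel D) (hν : ν.Generic) (a : Fin K)
    {ζ : ProbabilityMeasure ℝ} (hζD : ζ ∈ D) (hζ : ∀ b, mean ζ < mean (ν b)) :
    -((InformationTheory.klDiv (ζ : Measure ℝ) (ν a : Measure ℝ) / (K : ℝ≥0∞) : ℝ≥0∞) : EReal)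
      ≤ σ.errorRate hK ν a := by
  have hK0 : (0 : ℝ) < K := by exact_mod_cast (by omega : 0 < K)
  by_cases hkl : InformationTheory.klDiv (ζ : Measure ℝ) (ν a : Measure ℝ) = ∞
  · rw [hkl, ENNReal.top_div_of_ne_top (ENNReal.natCast_ne_top K)]
    simp
  set ν' : Problem K := Function.update ν a ζ with hν'
  have ha' : ν' a = ζ := Function.update_self ..
  have hne : ∀ b, b ≠ a → ν' b = ν b := fun b hb => Function.update_of_ne hb ..
  have hν'D : ν'.InModel D := by
    intro b
    by_cases hb : b = a
    · rw [hb, ha']; exact hζD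
    · rw [hne b hb]; exact hνD b
  have hν'g : ν'.Generic := by
    intro j k hjk
    by_cases hj : j = a
    · rw [hj, ha', hne k (hj ▸ hjk.symm)]
      exact (hζ k).ne
    · by_cases hk : k = a
      · rw [hk, ha', hne j hj]
        exact (hζ j).ne'
      · rw [hne j hj, hne k hk]
        exact hν j k hjk
  have hworst : ν'.IsWorst a := by
    intro b
    by_cases hb : b = a
    · rw [hb]
    · rw [ha', hne b hb]
      exact (hζ b).le
  have : Nontrivial (Fin K) := Fin.nontrivial_iff_two_le.mpr hK
  obtain ⟨b, hb⟩ := Finite.exists_max fun b => mean (ν' b)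
  have hba : b ≠ a := by
    rintro rfl
    obtain ⟨c, hc⟩ := exists_ne b
    have h1 := hb c
    rw [ha', hne c hc] at h1
    exact absurd (hζ c) h1.not_gt
  -- Under `ν'` the best arm `b ≠ a` is recommended with probability tending to `1`.
  have hp : Tendsto (fun T => ((σ K hK T).errorProb ν' a).toReal) atTop (𝓝 1) := by
    have hq := (ENNReal.tendsto_toReal ENNReal.zero_ne_top).comp (hcons K hK ν' hν'D hν'g b hb)
    refine tendsto_of_tendsto_of_tendsto_of_le_of_le
      (g := fun T => 1 - ((σ K hK T).errorProb ν' b).toReal) (h := fun _ => 1)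
      (by simpa using hq.const_sub 1) tendsto_const_nhds (fun T => ?_)
      (fun T => measureReal_le_one)
    have hu : (Set.univ : Set (History 𝒰 T))
        ⊆ {h | (σ K hK T).recommend h ≠ a} ∪ {h | (σ K hK T).recommend h ≠ b} := by
      intro h _
      by_cases h1 : (σ K hK T).recommend h = a
      · exact Or.inr (by simpa [h1] using hba.symm)
      · exact Or.inl h1
    have h1 := (measureReal_mono (μ := (σ K hK T).law ν' T) hu).trans (measureReal_union_le _ _)
    rw [probReal_univ] at h1
    change 1 - ((σ K hK T).law ν' T).real _ ≤ ((σ K hK T).law ν' T).real _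
    linarith
  set kl := (InformationTheory.klDiv (ζ : Measure ℝ) (ν a : Measure ℝ)).toReal with hkl_def
  have hkl_nonneg : 0 ≤ kl := ENNReal.toReal_nonneg
  have hcoe : ((InformationTheory.klDiv (ζ : Measure ℝ) (ν a : Measure ℝ) / (K : ℝ≥0∞) : ℝ≥0∞)
      : EReal) = ((kl / K : ℝ) : EReal) := by
    rw [← EReal.coe_ennreal_toReal (ENNReal.div_ne_top hkl (by exact_mod_cast hK0.ne')),
      ENNReal.toReal_div, ENNReal.toReal_natCast]
  rw [hcoe, ← EReal.coe_neg]
  refine EReal.ge_of_forall_gt_iff_ge.mp fun c hc => ?_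
  have hc : kl * (1 / K) < -c := by
    have := EReal.coe_lt_coe_iff.mp hc
    rw [mul_one_div]; linarith
  -- The limsup bound `1 / K` holds eventually only up to slack, so `r` is taken slightly above it.
  obtain ⟨r, hr1, hr2⟩ : ∃ r : ℝ, 1 / K < r ∧ kl * r < -c := by
    have h1 : ∀ᶠ r in 𝓝[>] (1 / K : ℝ), kl * r < -c :=
      ((continuous_const.mul continuous_id).tendsto _ |>.mono_left nhdsWithin_le_nhds).eventually
        (gt_mem_nhds hc)
    obtain ⟨r, h2, h3⟩ := (h1.and self_mem_nhdsWithin).exists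
    exact ⟨r, h3, h2⟩
  have hr0 : 0 < r := lt_trans (by positivity) hr1
  have hN : ∀ᶠ T : ℕ in atTop,
      (σ K hK T).expectedPulls ν' a / (T : ℝ≥0∞) < ENNReal.ofReal r := by
    refine eventually_lt_of_limsup_lt ((hbal K hK ν' hν'D hν'g a hworst).trans_lt ?_)
    rw [← ENNReal.ofReal_natCast, ← ENNReal.ofReal_one, ← ENNReal.ofReal_div_of_pos hK0]
    exact (ENNReal.ofReal_lt_ofReal_iff hr0).mpr hr1
  -- This is `1 / T` times the logarithm of the change-of-measure bound, with the pull frequency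
  -- replaced by `r`.
  have hlim : Tendsto (fun T : ℕ => Real.log ((σ K hK T).errorProb ν' a).toReal / (T : ℝ)
      - (kl * r + 1 / (T : ℝ)) / ((σ K hK T).errorProb ν' a).toReal) atTop (𝓝 (-(kl * r))) := by
    have h1 : Tendsto (fun T : ℕ => Real.log ((σ K hK T).errorProb ν' a).toReal * (1 / (T : ℝ)))
        atTop (𝓝 (Real.log 1 * 0)) :=
      (hp.log one_ne_zero).mul tendsto_one_div_atTop_nhds_zero_nat
    have h2 := h1.sub ((tendsto_one_div_atTop_nhds_zero_nat.const_add (kl * r)).div hp one_ne_zero)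
    simpa [div_eq_mul_inv] using h2
  have hev := hlim.eventually (lt_mem_nhds (a := c) (by linarith))
  unfold StrategySeq.errorRate
  refine le_liminf_of_le (by isBoundedDefault) ?_
  filter_upwards [hN, hev, hp.eventually (lt_mem_nhds zero_lt_one), eventually_gt_atTop 0]
    with T hNT hT hpT hT0
  have hT0' : (0 : ℝ) < T := by exact_mod_cast hT0
  have hkey := (σ K hK T).mul_exp_neg_le_errorProb ν ν' a hne (by rwa [ha']) hpT
  rw [ha', ← hkl_def] at hkey
  set p := ((σ K hK T).errorProb ν' a).toReal
  set q := ((σ K hK T).errorProb ν a).toReal with hq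
  set n := ((σ K hK T).expectedPulls ν' a).toReal
  have hn : n / T ≤ r := by
    have := ENNReal.toReal_mono ENNReal.ofReal_ne_top hNT.le
    rwa [ENNReal.toReal_div, ENNReal.toReal_natCast, ENNReal.toReal_ofReal hr0.le] at this
  have hq0 : 0 < q := lt_of_lt_of_le (by positivity) hkey
  have hlog := Real.log_le_log (by positivity) hkey
  rw [Real.log_mul hpT.ne' (Real.exp_ne_zero _), Real.log_exp] at hlog
  have hfin : c ≤ Real.log q / T := by
    have h1 : (Real.log p + -((kl * n + 1) / p)) / T ≤ Real.log q / T := by gcongr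
    have h2 : (Real.log p + -((kl * n + 1) / p)) / T
        = Real.log p / T - (kl * (n / T) + 1 / T) / p := by
      field_simp
      ring
    have h3 : (kl * (n / T) + 1 / T) / p ≤ (kl * r + 1 / T) / p := by gcongr
    linarith
  have hlogq : ENNReal.log ((σ K hK T).errorProb ν a) = (Real.log q : EReal) := by
    rw [← ENNReal.log_ofReal_of_pos hq0, hq, ENNReal.ofReal_toReal]
    exact measure_ne_top _ _
  rw [hlogq, ← EReal.coe_coe_eq_natCast, ← EReal.coe_div]
  exact EReal.coe_le_coe_iff.mpr hfin

/-! ### Pruning to the best arms and conclusion -/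

/-- The best `i + 1` arms of a generic problem. -/
lemma Problem.exists_finset_best (ν : Problem K) (hν : ν.Generic) {a : Fin K} (ha : ν.IsBest a)
    (i : Fin K) :
    ∃ A : Finset (Fin K), A.card = (i : ℕ) + 1 ∧ a ∈ A ∧ ∀ b ∈ A, ν.orderedMean i ≤ mean (ν b) := by
  set s := Tuple.sort (fun a => -mean (ν a)) with hs
  have hmono : Monotone fun j => -mean (ν (s j)) := Tuple.monotone_sort fun a => -mean (ν a)
  refine ⟨(Finset.Iic i).map s.toEmbedding, by simp, ?_, ?_⟩
  · rw [Finset.mem_map_equiv, Finset.mem_Iic]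
    by_contra! h
    have h1 := hmono h.le
    simp only [Equiv.apply_symm_apply, neg_le_neg_iff] at h1
    by_cases h2 : s i = a
    · rw [← h2, Equiv.symm_apply_apply] at h
      exact lt_irrefl _ h
    · exact hν _ _ h2 (le_antisymm (ha _) h1)
  · intro b hb
    rw [Finset.mem_map_equiv, Finset.mem_Iic] at hb
    have h1 := neg_le_neg_iff.mp (hmono hb)
    rwa [Equiv.apply_symm_apply] at h1

end BestArm

open BestArm in
theorem theorem2 {𝒰 : Type*} [MeasurableSpace 𝒰]
    (D : Set (ProbabilityMeasure ℝ)) (hD : IsModel D)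
    (σ : StrategySeq 𝒰)
    (hcons : σ.Consistent D) (hbal : σ.BalancedAgainstWorst D) (hprune : σ.CleverlyPrunes D)
    (K : ℕ) (hK : 2 ≤ K) (ν : Problem K) (hνD : ν.InModel D) (hν : ν.Generic)
    (a : Fin K) (ha : ν.IsBest a) :
    -(((⨅ k : Fin K, ⨅ _ : 2 ≤ (k : ℕ) + 1,
        Linf D (ν.orderedMean k) (ν a) / (((k : ℕ) + 1 : ℕ) : ℝ≥0∞) : ℝ≥0∞)) : EReal)
      ≤ σ.errorRate hK ν a := by
  rw [EReal.neg_le]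
  -- Truncating at `0` moves the claim to `ℝ≥0∞`, where the infima can be handled one term at a
  -- time.
  have hle : -σ.errorRate hK ν a ≤ ((-σ.errorRate hK ν a).toENNReal : EReal) := by
    rw [EReal.coe_toENNReal_eq_max]
    exact le_max_right _ _
  refine hle.trans (EReal.coe_ennreal_le_coe_ennreal_iff.mpr ?_)
  refine le_iInf fun i => le_iInf fun hi => ?_
  obtain ⟨A, hAcard, haA, hA⟩ := ν.exists_finset_best hν ha i
  rw [← hAcard] at hi ⊢
  -- The division is cleared only to expose the infimum in `Linf`; it is restored once `ζ` is fixed.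
  rw [ENNReal.le_div_iff_mul_le (Or.inl (by exact_mod_cast (by omega : A.card ≠ 0)))
    (Or.inl (ENNReal.natCast_ne_top _))]
  refine le_iInf₂ fun ζ hζD => le_iInf fun hζ => ?_
  rw [← ENNReal.le_div_iff_mul_le (Or.inl (by exact_mod_cast (by omega : A.card ≠ 0)))
    (Or.inl (ENNReal.natCast_ne_top _)), ← EReal.coe_ennreal_le_coe_ennreal_iff]
  obtain ⟨a', ha'⟩ : ∃ a', A.orderEmbOfFin rfl a' = a := by
    have : a ∈ Set.range (A.orderEmbOfFin rfl) := by simpa using haA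
    exact this
  have hrestrict : ν.restrict A a' = ν a := congrArg ν ha'
  have hgen : (ν.restrict A).Generic := fun j k hjk =>
    hν _ _ fun h => hjk ((A.orderEmbOfFin rfl).injective h)
  have hbest : (ν.restrict A).IsBest a' := fun b => by
    rw [hrestrict]
    exact ha _
  -- Every arm kept in `A` has mean at least `ν.orderedMean i`, hence above that of `ζ`.
  have hlow := σ.neg_klDiv_div_le_errorRate hcons hbal hi (ν := ν.restrict A)
    (fun b => hνD _) hgen a' hζD
    (fun b => hζ.trans_le (hA _ (A.orderEmbOfFin_mem rfl b)))
  rw [hrestrict] at hlow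
  have hrate := hlow.trans (hprune K hK ν hνD hν A hi a a' ha hbest hrestrict)
  have hnonneg := EReal.coe_ennreal_nonneg
    (InformationTheory.klDiv (ζ : Measure ℝ) (ν a : Measure ℝ) / (A.card : ℝ≥0∞))
  by_cases h0 : 0 ≤ -σ.errorRate hK ν a
  · rw [EReal.coe_toENNReal h0]
    exact EReal.neg_le.mp hrate
  · rw [EReal.toENNReal_of_nonpos (not_le.mp h0).le]
    simpa using hnonneg
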